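/- Let $(X,\mathcal F,\mu)$ be a $\sigma$-finite measure space and let $\mathcal A\subseteq\mathcal F$ be a $\sigma$-subalgebra such that $(X,\mathcal A,\mu|_{\mathcal A})$ is $\sigma$-finite; functions are identified when they agree almost everywhere. Let $E$ be the conditional expectation relative to $\mathcal A$, defined for all nonnegative measurable functions (with values in $[0,\infty]$) and, by $E(f)=E(f^+)-E(f^-)$ on real and imaginary parts, for all measurable $f:X\to\mathbb C$ that are conditionable, i.e. satisfy $E(|f|)<\infty$ a.e. For measurable $w,u:X\to\mathbb C$, say that $M_wEM_u$ is a bounded operator on $L^2(\mathcal F)=L^2(X,\mathcal F,\mu;\mathbb C)$ if for every $f\in L^2(\mathcal F)$ the function $uf$ is conditionable and $wE(uf)\in L^2(\mathcal F)$, and the map $f\mapsto wE(uf)$ is bounded on $L^2(\mathcal F)$. For a bounded operator $T$ on a complex Hilbert space $\mathcal H$ with spectral radius $r(T)$, and for each integer $m\ge1$, put $$d_m=\frac1{1/m+r(T)},\qquad R_m=\Big(\sum_{n=0}^\infty d_m^{2n}\,T^{*n}T^n\Big)^{1/2},$$ where the series converges in norm and $R_m$ is positive and invertible. The spectral radius algebra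 of $T$ is $$\mathcal B_T=\Big\{S\in\mathcal B(\mathcal H):\ \sup_{m\ge1}\|R_mSR_m^{-1}\|<\infty\Big\}.$$ Proposition. Let $w,u:X\to\mathbb C$ be conditionable, assume that $E(|u|^2)\in L^\infty(\mathcal A)$, and assume that $M_wEM_u$ is a bounded operator on $L^2(\mathcal F)$. If $a:X\to\mathbb R$ is $\mathcal A$-measurable with $a\ge0$, and $M_{a\bar u}EM_u$ is a bounded operator on $L^2(\mathcal F)$, then $$M_{a\bar u}EM_u\in\mathcal B_{M_wEM_u}.$$ -/

import Mathlib

open MeasureTheory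
open scoped ENNReal NNReal ComplexConjugate

noncomputable section

namespace SpectralRadiusAlgebra

variable {H : Type*} [NormedAddCommGroup H] [InnerProductSpace ℂ H] [CompleteSpace H]

/-- The number `d_m = 1 / (1/m + r(T))`, with `r(T)` the spectral radius of `T` (it is used for
`m ≥ 1` only). The spectral radius of a bounded operator is finite, so `toReal` loses nothing. -/
def dCoeff (T : H →L[ℂ] H) (m : ℕ) : ℝ :=
  1 / (1 / (m : ℝ) + (spectralRadius ℂ T).toReal)

/-- `R_m(T) = (∑_{n ≥ 0} d_m^{2n} T*^n T^n)^{1/2}`: the positive square root of the sum of a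
series of positive operators that converges in the operator norm. -/
def R (T : H →L[ℂ] H) (m : ℕ) : H →L[ℂ] H :=
  CFC.sqrt (∑' n : ℕ, (dCoeff T m ^ (2 * n)) • (ContinuousLinearMap.adjoint T ^ n * T ^ n))

/-- The spectral radius algebra `B_T`: all bounded operators `S` with
`sup_{m ≥ 1} ‖R_m S R_m⁻¹‖ < ∞`. (`R_m` is invertible, as `R_m ^ 2 ≥ 1`; `Ring.inverse` is the
inverse in the ring of bounded operators.) -/
def spectralRadiusAlgebra (T : H →L[ℂ] H) : Set (H →L[ℂ] H) :=
  {S | BddAbove ((fun m : ℕ => ‖R T m * S * Ring.inverse (R T m)‖) '' {m | 1 ≤ m})}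

end SpectralRadiusAlgebra

namespace WCE

variable {X : Type*} (𝓐 : MeasurableSpace X) {𝓕 : MeasurableSpace X} (μ : @Measure X 𝓕)

/-- `E(|f|²)`, the conditional expectation of a nonnegative function (values in `[0, ∞]`). -/
def condSq (f : X → ℂ) : X → ℝ≥0∞ :=
  condLExp 𝓐 μ (fun x => ‖f x‖ₑ ^ 2)

/-- `f` is conditionable, i.e. belongs to
`𝓓(E) = {f ∈ L⁰(𝓕) : E(|f|) ∈ L⁰(𝓐)}`: it is measurable and the conditional expectation
of the nonnegative function `|f|` is finite almost everywhere. -/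
def Conditionable (f : X → ℂ) : Prop :=
  AEStronglyMeasurable[𝓕] f μ ∧ ∀ᵐ x ∂μ, condLExp 𝓐 μ (fun x => ‖f x‖ₑ) x < ∞

/-- The conditional expectation of a real function `f`, as `E(f⁺) - E(f⁻)`; meaningful when
`E(|f|) < ∞` almost everywhere. The function `f` need not be integrable. -/
def condReal (f : X → ℝ) : X → ℝ := fun x =>
  (condLExp 𝓐 μ (fun y => ENNReal.ofReal (f y)) x).toReal -
    (condLExp 𝓐 μ (fun y => ENNReal.ofReal (-f y)) x).toReal

/-- The conditional expectation `E(f) = E(Re f) + i E(Im f)` of a conditionable complex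
function. -/
def condE (f : X → ℂ) : X → ℂ := fun x =>
  (condReal 𝓐 μ (fun y => (f y).re) x : ℂ) + Complex.I * (condReal 𝓐 μ (fun y => (f y).im) x : ℂ)

/-- `M_w E M_u` is an everywhere defined bounded operator on `L²(𝓕)`, and equals `T`: for every
`f ∈ L²(𝓕)` the function `u f` is conditionable and `T f = w E(u f)` almost everywhere. -/
def IsWCE (w u : X → ℂ) (T : Lp ℂ 2 μ →L[ℂ] Lp ℂ 2 μ) : Prop :=
  ∀ f : Lp ℂ 2 μ, Conditionable 𝓐 μ (fun x => u x * f x) ∧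
    T f =ᵐ[μ] fun x => w x * condE 𝓐 μ (fun y => u y * f y) x

end WCE

end

open Filter

/-! Write `T` for the operator with weights `w`, `u` and `S` for the one with weights `a ū`, `u`.
The point is that `S` commutes with every `Q = T*ⁿTⁿ`. It then commutes with `R_m`, so conjugation
by `R_m` fixes `S` and `‖S‖` bounds the supremum. Pulling `𝓐`-measurable factors out of `E` gives `T
S = N T`, where `N` is multiplication by the real function `m = a E(|u|²)` (`comp_apply_ae`); `N`
commutes with `T`, hence with `T*`. For `n ≥ 1` this yields `Q S = N Q = Q N`. As `S`, `N`, `Q` are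
self-adjoint, taking adjoints in `Q S = N Q` gives `S Q = Q N = Q S` (`commute_star_pow_mul_pow`).
To avoid needing a bound on `m`, the argument is run on the sets `{|m| ≤ k}`, which exhaust `X`;
their indicators commute with `S` and `T`. -/

namespace WCE

/-! ### Linearity, pull-out and integrals for `E` on conditionable functions -/

section ConditionalExpectation

variable {X : Type*} {𝓐 𝓕 : MeasurableSpace X} {μ : @Measure X 𝓕}

/-- Pull-out property of the conditional expectation of nonnegative functions. -/
theorem condLExp_mul_of_measurable (h𝓐 : 𝓐 ≤ 𝓕) [SigmaFinite (μ.trim h𝓐)] {φ f : X → ℝ≥0∞}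
    (hφ : Measurable[𝓐] φ) (hf : AEMeasurable f μ) :
    condLExp 𝓐 μ (fun x => φ x * f x) =ᵐ[μ] fun x => φ x * condLExp 𝓐 μ f x := by
  refine (ae_eq_condLExp h𝓐 μ _ (hφ.mul (measurable_condLExp 𝓐 μ f)) fun s hs => ?_).symm
  -- The measures with densities `E(f)` and `f` agree on `𝓐`, so they give the same integral to the
  -- `𝓐`-measurable function `φ 1_s`.
  have htrim : (μ.withDensity (condLExp 𝓐 μ f)).trim h𝓐 = (μ.withDensity f).trim h𝓐 := by
    refine @Measure.ext _ 𝓐 _ _ fun t ht => ?_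
    rw [trim_measurableSet_eq h𝓐 ht, trim_measurableSet_eq h𝓐 ht,
      withDensity_apply _ (h𝓐 t ht), withDensity_apply _ (h𝓐 t ht), setLIntegral_condLExp h𝓐 μ f ht]
  have hψ : Measurable[𝓐] (s.indicator φ) := hφ.indicator hs
  have hψ' : AEMeasurable (s.indicator φ) μ := (hψ.mono h𝓐 le_rfl).aemeasurable
  have key : ∀ g : X → ℝ≥0∞, AEMeasurable g μ →
      ∫⁻ x in s, φ x * g x ∂μ = ∫⁻ x, s.indicator φ x ∂((μ.withDensity g).trim h𝓐) := by
    intro g hg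
    rw [lintegral_trim h𝓐 hψ, lintegral_withDensity_eq_lintegral_mul₀ hg hψ',
      ← lintegral_indicator (h𝓐 s hs)]
    refine lintegral_congr fun x => ?_
    by_cases hx : x ∈ s <;> simp [hx, mul_comm]
  have h := key _ (measurable_condLExp' 𝓐 μ f).aemeasurable
  rw [htrim, ← key f hf] at h
  exact h

theorem condLExp_lt_top_of_le {f g : X → ℝ≥0∞} (hfg : ∀ᵐ x ∂μ, f x ≤ g x)
    (hg : ∀ᵐ x ∂μ, condLExp 𝓐 μ g x < ∞) : ∀ᵐ x ∂μ, condLExp 𝓐 μ f x < ∞ := by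
  filter_upwards [condLExp_mono (mΩ := 𝓐) hfg, hg] with x h1 h2 using h1.trans_lt h2

theorem condLExp_add_lt_top {f g : X → ℝ≥0∞} (hfm : AEMeasurable f μ)
    (hf : ∀ᵐ x ∂μ, condLExp 𝓐 μ f x < ∞) (hg : ∀ᵐ x ∂μ, condLExp 𝓐 μ g x < ∞) :
    ∀ᵐ x ∂μ, condLExp 𝓐 μ (f + g) x < ∞ := by
  filter_upwards [condLExp_add_left (mΩ := 𝓐) g hfm, hf, hg] with x h h1 h2
  rw [h]
  exact ENNReal.add_lt_top.2 ⟨h1, h2⟩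

theorem condLExp_mul_lt_top (h𝓐 : 𝓐 ≤ 𝓕) [SigmaFinite (μ.trim h𝓐)] {φ f : X → ℝ≥0∞}
    (hφ : Measurable[𝓐] φ) (hφ' : ∀ x, φ x < ∞) (hfm : AEMeasurable f μ)
    (hf : ∀ᵐ x ∂μ, condLExp 𝓐 μ f x < ∞) :
    ∀ᵐ x ∂μ, condLExp 𝓐 μ (fun x => φ x * f x) x < ∞ := by
  filter_upwards [condLExp_mul_of_measurable h𝓐 hφ hfm, hf] with x h h1
  rw [h]
  exact ENNReal.mul_lt_top (hφ' x) h1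

/-- `E(f) = E(p) - E(q)` for every decomposition `f = p - q` into nonnegative functions with
finite conditional expectation. -/
theorem condReal_eq_sub {f : X → ℝ} {p q : X → ℝ≥0∞} (hf : AEMeasurable f μ)
    (hp' : ∀ᵐ x ∂μ, p x < ∞) (hq' : ∀ᵐ x ∂μ, q x < ∞) (hEp : ∀ᵐ x ∂μ, condLExp 𝓐 μ p x < ∞)
    (hEq : ∀ᵐ x ∂μ, condLExp 𝓐 μ q x < ∞) (h : ∀ᵐ x ∂μ, f x = (p x).toReal - (q x).toReal) :
    condReal 𝓐 μ f =ᵐ[μ] fun x => (condLExp 𝓐 μ p x).toReal - (condLExp 𝓐 μ q x).toReal := by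
  have hle : ∀ᵐ x ∂μ, ENNReal.ofReal (f x) ≤ p x := by
    filter_upwards [h, hp'] with x h h1
    rw [h]
    refine ENNReal.ofReal_le_of_le_toReal ?_
    linarith [ENNReal.toReal_nonneg (a := q x)]
  have hle' : ∀ᵐ x ∂μ, ENNReal.ofReal (-f x) ≤ q x := by
    filter_upwards [h, hq'] with x h h1
    rw [h]
    refine ENNReal.ofReal_le_of_le_toReal ?_
    linarith [ENNReal.toReal_nonneg (a := p x)]
  -- `f⁺ + q = f⁻ + p` involves no subtraction, so `E` applies in `[0, ∞]`; finiteness then allows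
  -- rearranging in `ℝ`.
  have hsum : ((fun x => ENNReal.ofReal (f x)) + q : X → ℝ≥0∞) =ᵐ[μ]
      ((fun x => ENNReal.ofReal (-f x)) + p : X → ℝ≥0∞) := by
    filter_upwards [h, hp', hq'] with x h h1 h2
    simp only [Pi.add_apply]
    rw [← ENNReal.toReal_eq_toReal_iff' (by finiteness) (by finiteness),
      ENNReal.toReal_add (by finiteness) (by finiteness),
      ENNReal.toReal_add (by finiteness) (by finiteness), ENNReal.toReal_ofReal',
      ENNReal.toReal_ofReal']
    have := max_zero_sub_max_neg_zero_eq_self (f x)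
    linarith
  filter_upwards [condLExp_congr_ae (mΩ := 𝓐) hsum,
    condLExp_add_left (mΩ := 𝓐) (X := fun x => ENNReal.ofReal (f x)) q hf.ennreal_ofReal,
    condLExp_add_left (mΩ := 𝓐) (X := fun x => ENNReal.ofReal (-f x)) p hf.neg.ennreal_ofReal,
    hEp, hEq, condLExp_lt_top_of_le hle hEp, condLExp_lt_top_of_le hle' hEq]
    with x h0 h1 h2 h3 h4 h5 h6
  rw [h1, h2] at h0
  simp only [Pi.add_apply] at h0
  have := congrArg ENNReal.toReal h0
  rw [ENNReal.toReal_add h5.ne h4.ne, ENNReal.toReal_add h6.ne h3.ne] at this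
  simp only [condReal]
  linarith

theorem condLExp_ofReal_lt_top {f : X → ℝ} (hf : ∀ᵐ x ∂μ, condLExp 𝓐 μ (fun x => ‖f x‖ₑ) x < ∞) :
    ∀ᵐ x ∂μ, condLExp 𝓐 μ (fun x => ENNReal.ofReal (f x)) x < ∞ :=
  condLExp_lt_top_of_le (.of_forall fun x => Real.ofReal_le_enorm (f x)) hf

theorem condLExp_ofReal_neg_lt_top {f : X → ℝ}
    (hf : ∀ᵐ x ∂μ, condLExp 𝓐 μ (fun x => ‖f x‖ₑ) x < ∞) :
    ∀ᵐ x ∂μ, condLExp 𝓐 μ (fun x => ENNReal.ofReal (-f x)) x < ∞ :=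
  condLExp_ofReal_lt_top (f := fun x => -f x) (by simpa using hf)

theorem toReal_ofReal_sub (r : ℝ) :
    (ENNReal.ofReal r).toReal - (ENNReal.ofReal (-r)).toReal = r := by
  rw [ENNReal.toReal_ofReal', ENNReal.toReal_ofReal', max_zero_sub_max_neg_zero_eq_self]

theorem condReal_neg (f : X → ℝ) (x : X) :
    condReal 𝓐 μ (fun y => -f y) x = -condReal 𝓐 μ f x := by
  simp [condReal]

theorem condReal_add {f g : X → ℝ} (hfm : AEMeasurable f μ) (hgm : AEMeasurable g μ)
    (hf : ∀ᵐ x ∂μ, condLExp 𝓐 μ (fun x => ‖f x‖ₑ) x < ∞)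
    (hg : ∀ᵐ x ∂μ, condLExp 𝓐 μ (fun x => ‖g x‖ₑ) x < ∞) :
    condReal 𝓐 μ (fun x => f x + g x) =ᵐ[μ] fun x => condReal 𝓐 μ f x + condReal 𝓐 μ g x := by
  have hf1 := condLExp_ofReal_lt_top hf
  have hf2 := condLExp_ofReal_neg_lt_top hf
  have hg1 := condLExp_ofReal_lt_top hg
  have hg2 := condLExp_ofReal_neg_lt_top hg
  have hmf1 := hfm.ennreal_ofReal
  have hmf2 : AEMeasurable (fun x => ENNReal.ofReal (-f x)) μ := hfm.neg.ennreal_ofReal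
  filter_upwards [condReal_eq_sub (𝓐 := 𝓐) (f := fun x => f x + g x)
      (p := (fun x => ENNReal.ofReal (f x)) + fun x => ENNReal.ofReal (g x))
      (q := (fun x => ENNReal.ofReal (-f x)) + fun x => ENNReal.ofReal (-g x))
      (hfm.add hgm)
      (.of_forall fun x => by simp) (.of_forall fun x => by simp)
      (condLExp_add_lt_top hmf1 hf1 hg1) (condLExp_add_lt_top hmf2 hf2 hg2)
      (.of_forall fun x => by
        simp only [Pi.add_apply]
        rw [ENNReal.toReal_add (by simp) (by simp), ENNReal.toReal_add (by simp) (by simp)]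
        linarith [toReal_ofReal_sub (f x), toReal_ofReal_sub (g x)]),
    condLExp_add_left (mΩ := 𝓐) (fun x => ENNReal.ofReal (g x)) hmf1,
    condLExp_add_left (mΩ := 𝓐) (fun x => ENNReal.ofReal (-g x)) hmf2, hf1, hf2, hg1, hg2]
    with x h h1 h2 h3 h4 h5 h6
  rw [h, h1, h2]
  simp only [Pi.add_apply, condReal]
  rw [ENNReal.toReal_add h3.ne h5.ne, ENNReal.toReal_add h4.ne h6.ne]
  ring

/-- Since `φ f = (φ⁺f⁺ + φ⁻f⁻) - (φ⁺f⁻ + φ⁻f⁺)`, `condReal_eq_sub` reduces this to the nonnegative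
pull-out. -/
theorem condReal_mul (h𝓐 : 𝓐 ≤ 𝓕) [SigmaFinite (μ.trim h𝓐)] {φ f : X → ℝ}
    (hφ : Measurable[𝓐] φ) (hfm : AEMeasurable f μ)
    (hf : ∀ᵐ x ∂μ, condLExp 𝓐 μ (fun x => ‖f x‖ₑ) x < ∞) :
    condReal 𝓐 μ (fun x => φ x * f x) =ᵐ[μ] fun x => φ x * condReal 𝓐 μ f x := by
  have hf1 := condLExp_ofReal_lt_top hf
  have hf2 := condLExp_ofReal_neg_lt_top hf
  have hmf1 := hfm.ennreal_ofReal
  have hmf2 : AEMeasurable (fun x => ENNReal.ofReal (-f x)) μ := hfm.neg.ennreal_ofReal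
  have hφ1 : Measurable[𝓐] (fun x => ENNReal.ofReal (φ x)) := hφ.ennreal_ofReal
  have hφ2 : Measurable[𝓐] (fun x => ENNReal.ofReal (-φ x)) := hφ.neg.ennreal_ofReal
  have hm1 := (hφ1.mono h𝓐 le_rfl).aemeasurable (μ := μ)
  have hm2 := (hφ2.mono h𝓐 le_rfl).aemeasurable (μ := μ)
  have e1 : ∀ x, ENNReal.ofReal (φ x) < ∞ := fun x => by simp
  have e2 : ∀ x, ENNReal.ofReal (-φ x) < ∞ := fun x => by simp
  filter_upwards [condReal_eq_sub (𝓐 := 𝓐) (f := fun x => φ x * f x)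
      (p := (fun x => ENNReal.ofReal (φ x) * ENNReal.ofReal (f x)) +
        fun x => ENNReal.ofReal (-φ x) * ENNReal.ofReal (-f x))
      (q := (fun x => ENNReal.ofReal (φ x) * ENNReal.ofReal (-f x)) +
        fun x => ENNReal.ofReal (-φ x) * ENNReal.ofReal (f x))
      ((hφ.mono h𝓐 le_rfl).aemeasurable.mul hfm)
      (.of_forall fun x => by simp only [Pi.add_apply]; finiteness)
      (.of_forall fun x => by simp only [Pi.add_apply]; finiteness)
      (condLExp_add_lt_top (hm1.mul hmf1) (condLExp_mul_lt_top h𝓐 hφ1 e1 hmf1 hf1)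
        (condLExp_mul_lt_top h𝓐 hφ2 e2 hmf2 hf2))
      (condLExp_add_lt_top (hm1.mul hmf2) (condLExp_mul_lt_top h𝓐 hφ1 e1 hmf2 hf2)
        (condLExp_mul_lt_top h𝓐 hφ2 e2 hmf1 hf1))
      (.of_forall fun x => by
        simp only [Pi.add_apply]
        rw [ENNReal.toReal_add (by finiteness) (by finiteness),
          ENNReal.toReal_add (by finiteness) (by finiteness)]
        simp only [ENNReal.toReal_mul]
        conv_lhs => rw [← toReal_ofReal_sub (f x), ← toReal_ofReal_sub (φ x)]
        ring),
    condLExp_add_left (mΩ := 𝓐) (fun x => ENNReal.ofReal (-φ x) * ENNReal.ofReal (-f x))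
      (hm1.mul hmf1),
    condLExp_add_left (mΩ := 𝓐) (fun x => ENNReal.ofReal (-φ x) * ENNReal.ofReal (f x))
      (hm1.mul hmf2),
    condLExp_mul_of_measurable h𝓐 hφ1 hmf1, condLExp_mul_of_measurable h𝓐 hφ1 hmf2,
    condLExp_mul_of_measurable h𝓐 hφ2 hmf1, condLExp_mul_of_measurable h𝓐 hφ2 hmf2,
    hf1, hf2] with x h h1 h2 h3 h4 h5 h6 h7 h8
  change condLExp 𝓐 μ ((fun x => ENNReal.ofReal (φ x) * ENNReal.ofReal (f x)) + _) x = _ at h1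
  change condLExp 𝓐 μ ((fun x => ENNReal.ofReal (φ x) * ENNReal.ofReal (-f x)) + _) x = _ at h2
  rw [h, h1, h2]
  simp only [Pi.add_apply, Pi.mul_def, condReal]
  rw [h3, h4, h5, h6, ENNReal.toReal_add (by finiteness) (by finiteness),
    ENNReal.toReal_add (by finiteness) (by finiteness)]
  simp only [ENNReal.toReal_mul]
  conv_rhs => rw [← toReal_ofReal_sub (φ x)]
  ring

theorem condReal_congr {f g : X → ℝ} (h : f =ᵐ[μ] g) : condReal 𝓐 μ f =ᵐ[μ] condReal 𝓐 μ g := by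
  filter_upwards [
    condLExp_congr_ae (mΩ := 𝓐) (h.fun_comp ENNReal.ofReal),
    condLExp_congr_ae (mΩ := 𝓐) (h.fun_comp fun r => ENNReal.ofReal (-r))] with x h1 h2
  simp only [condReal]
  exact congrArg₂ (· - ·) (congrArg _ h1) (congrArg _ h2)

theorem integrable_condReal (h𝓐 : 𝓐 ≤ 𝓕) [SigmaFinite (μ.trim h𝓐)] {f : X → ℝ}
    (hf : Integrable f μ) : Integrable (condReal 𝓐 μ f) μ ∧
      ∫ x, condReal 𝓐 μ f x ∂μ = ∫ x, f x ∂μ := by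
  have key : ∀ g : X → ℝ, Integrable g μ →
      Integrable (fun x => (condLExp 𝓐 μ (fun y => ENNReal.ofReal (g y)) x).toReal) μ ∧
      ∫ x, (condLExp 𝓐 μ (fun y => ENNReal.ofReal (g y)) x).toReal ∂μ =
        (∫⁻ x, ENNReal.ofReal (g x) ∂μ).toReal := by
    intro g hg
    have hm := (measurable_condLExp' 𝓐 μ fun y => ENNReal.ofReal (g y)).aemeasurable (μ := μ)
    have hfin : ∫⁻ x, ENNReal.ofReal (g x) ∂μ ≠ ∞ :=
      ((lintegral_mono fun x => Real.ofReal_le_enorm (g x)).trans_lt hg.2).ne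
    refine ⟨integrable_toReal_of_lintegral_ne_top hm ?_, ?_⟩
    · rwa [lintegral_condLExp h𝓐]
    · rw [integral_toReal hm (condLExp_lt_top hfin), lintegral_condLExp h𝓐]
  obtain ⟨i1, e1⟩ := key f hf
  obtain ⟨i2, e2⟩ := key (fun x => -f x) hf.neg
  refine ⟨i1.sub i2, ?_⟩
  rw [integral_eq_lintegral_pos_part_sub_lintegral_neg_part hf, ← e1, ← e2, ← integral_sub i1 i2]
  rfl

theorem condE_congr {f g : X → ℂ} (h : f =ᵐ[μ] g) : condE 𝓐 μ f =ᵐ[μ] condE 𝓐 μ g := by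
  filter_upwards [condReal_congr (𝓐 := 𝓐) (h.fun_comp Complex.re),
    condReal_congr (𝓐 := 𝓐) (h.fun_comp Complex.im)] with x h1 h2
  simp only [condE]
  exact congrArg₂ (fun r s : ℝ => (r : ℂ) + Complex.I * s) h1 h2

theorem measurable_condE (f : X → ℂ) : Measurable[𝓐] (condE 𝓐 μ f) := by
  have h : ∀ g : X → ℝ, Measurable[𝓐] (condReal 𝓐 μ g) := fun g =>
    (measurable_condLExp 𝓐 μ _).ennreal_toReal.sub (measurable_condLExp 𝓐 μ _).ennreal_toReal
  exact (Complex.measurable_ofReal.comp (h _)).add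
    ((Complex.measurable_ofReal.comp (h _)).const_mul Complex.I)

theorem condE_conj (f : X → ℂ) (x : X) :
    condE 𝓐 μ (fun y => conj (f y)) x = conj (condE 𝓐 μ f x) := by
  simp only [condE, Complex.conj_re, Complex.conj_im, condReal_neg, map_add, map_mul,
    Complex.conj_ofReal, Complex.conj_I]
  push_cast
  ring

theorem integral_condE (h𝓐 : 𝓐 ≤ 𝓕) [SigmaFinite (μ.trim h𝓐)] {f : X → ℂ}
    (hf : Integrable f μ) : ∫ x, condE 𝓐 μ f x ∂μ = ∫ x, f x ∂μ := by
  obtain ⟨i1, e1⟩ := integrable_condReal h𝓐 (f := fun x => (f x).re) hf.re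
  obtain ⟨i2, e2⟩ := integrable_condReal h𝓐 (f := fun x => (f x).im) hf.im
  have h : ((∫ x, (f x).re ∂μ : ℝ) : ℂ) + (∫ x, (f x).im ∂μ : ℝ) * Complex.I = ∫ x, f x ∂μ :=
    integral_re_add_im hf
  simp only [condE]
  have j1 : Integrable (fun x => (condReal 𝓐 μ (fun y => (f y).re) x : ℂ)) μ := i1.ofReal
  have j2 : Integrable (fun x => (condReal 𝓐 μ (fun y => (f y).im) x : ℂ)) μ := i2.ofReal
  rw [← h, ← e1, ← e2, integral_add j1 (j2.const_mul Complex.I),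
    integral_const_mul, integral_complex_ofReal, integral_complex_ofReal, mul_comm Complex.I]

theorem Conditionable.re {f : X → ℂ} (hf : Conditionable 𝓐 μ f) :
    AEMeasurable (fun x => (f x).re) μ ∧
      ∀ᵐ x ∂μ, condLExp 𝓐 μ (fun x => ‖(f x).re‖ₑ) x < ∞ :=
  ⟨Complex.measurable_re.comp_aemeasurable hf.1.aemeasurable,
    condLExp_lt_top_of_le (.of_forall fun _ => enorm_le_iff_norm_le.2 (Complex.abs_re_le_norm _))
      hf.2⟩

theorem Conditionable.im {f : X → ℂ} (hf : Conditionable 𝓐 μ f) :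
    AEMeasurable (fun x => (f x).im) μ ∧
      ∀ᵐ x ∂μ, condLExp 𝓐 μ (fun x => ‖(f x).im‖ₑ) x < ∞ :=
  ⟨Complex.measurable_im.comp_aemeasurable hf.1.aemeasurable,
    condLExp_lt_top_of_le (.of_forall fun _ => enorm_le_iff_norm_le.2 (Complex.abs_im_le_norm _))
      hf.2⟩

theorem Conditionable.conj {f : X → ℂ} (hf : Conditionable 𝓐 μ f) :
    Conditionable 𝓐 μ fun x => conj (f x) :=
  ⟨Complex.continuous_conj.comp_aestronglyMeasurable hf.1, by
    simpa [enorm_eq_nnnorm] using hf.2⟩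

/-- Pull-out property of the conditional expectation of conditionable functions. -/
theorem condE_mul (h𝓐 : 𝓐 ≤ 𝓕) [SigmaFinite (μ.trim h𝓐)] {φ f : X → ℂ}
    (hφ : Measurable[𝓐] φ) (hf : Conditionable 𝓐 μ f) :
    condE 𝓐 μ (fun x => φ x * f x) =ᵐ[μ] fun x => φ x * condE 𝓐 μ f x := by
  have hr : Measurable[𝓐] fun x => (φ x).re := Complex.measurable_re.comp hφ
  have hi : Measurable[𝓐] fun x => (φ x).im := Complex.measurable_im.comp hφ
  have hmul : ∀ (ψ g : X → ℝ), Measurable[𝓐] ψ → AEMeasurable g μ →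
      (∀ᵐ x ∂μ, condLExp 𝓐 μ (fun x => ‖g x‖ₑ) x < ∞) →
      AEMeasurable (fun x => ψ x * g x) μ ∧
      ∀ᵐ x ∂μ, condLExp 𝓐 μ (fun x => ‖ψ x * g x‖ₑ) x < ∞ := by
    intro ψ g hψ hg hg'
    refine ⟨(hψ.mono h𝓐 le_rfl).aemeasurable.mul hg, ?_⟩
    simp only [enorm_mul]
    exact condLExp_mul_lt_top h𝓐 (measurable_enorm.comp hψ) (fun x => by simp) hg.enorm hg'
  obtain ⟨fr, fr'⟩ := hf.re
  obtain ⟨fi, fi'⟩ := hf.im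
  obtain ⟨m1, m1'⟩ := hmul _ _ hr fr fr'
  obtain ⟨m2, m2'⟩ := hmul _ _ hi fi fi'
  obtain ⟨m3, m3'⟩ := hmul _ _ hr fi fi'
  obtain ⟨m4, m4'⟩ := hmul _ _ hi fr fr'
  filter_upwards [condReal_mul h𝓐 hr fr fr', condReal_mul h𝓐 hi fi fi',
    condReal_mul h𝓐 hr fi fi', condReal_mul h𝓐 hi fr fr',
    condReal_add (g := fun x => -((φ x).im * (f x).im)) m1 m2.neg m1' (by simpa using m2'),
    condReal_add m3 m4 m3' m4'] with x h1 h2 h3 h4 h5 h6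
  simp only [condE, Complex.mul_re, Complex.mul_im, sub_eq_add_neg]
  rw [h5, h6, condReal_neg, h1, h2, h3, h4]
  conv_rhs => rw [← Complex.re_add_im (φ x)]
  push_cast
  linear_combination (-((φ x).im : ℂ) * condReal 𝓐 μ (fun y => (f y).im) x) * Complex.I_mul_I

end ConditionalExpectation

end WCE

/-! ### Commutation with `T*ⁿTⁿ` and membership in `B_T` -/

namespace SpectralRadiusAlgebra

/-- If `S` and `N` are self-adjoint, `T S = N T` and `N` commutes with `T`, then `S` commutes with
every `T*^n T^n`. -/
theorem commute_star_pow_mul_pow {A : Type*} [Ring A] [StarRing A] {S N T : A}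
    (hS : IsSelfAdjoint S) (hN : IsSelfAdjoint N) (hTS : T * S = N * T) (hNT : Commute N T)
    (n : ℕ) : Commute S (star T ^ n * T ^ n) := by
  have hNT' : Commute N (star T) := by
    simpa [hN.star_eq] using hNT.star_star
  -- The case `n = 0` is separate: `T S = N T` needs a factor `T` next to `S`.
  cases n with
  | zero => simp
  | succ n =>
    set Q := star T ^ (n + 1) * T ^ (n + 1) with hQ
    have hQs : star Q = Q := by simp [hQ]
    have hNQ : N * Q = Q * N := (hNT'.pow_right _).mul_right (hNT.pow_right _)
    have hQS : Q * S = N * Q := by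
      rw [hNQ, hQ, pow_succ T n]
      simp only [mul_assoc]
      rw [hTS, hNT.eq]
    have := congrArg star hQS
    rw [star_mul Q S, star_mul N Q, hS.star_eq, hN.star_eq, hQs] at this
    exact this.trans (hNQ.symm.trans hQS.symm)

variable {H : Type*} [NormedAddCommGroup H] [InnerProductSpace ℂ H] [CompleteSpace H]

/-- An operator commuting with every `T*^n T^n` commutes with every `R_m`, hence lies in `B_T`. -/
theorem mem_spectralRadiusAlgebra_of_commute {S T : H →L[ℂ] H}
    (h : ∀ n : ℕ, Commute S (ContinuousLinearMap.adjoint T ^ n * T ^ n)) :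
    S ∈ spectralRadiusAlgebra T := by
  refine ⟨‖S‖, ?_⟩
  rintro _ ⟨m, -, rfl⟩
  -- Commutation passes to the sum and to its square root by functional calculus. Convergence is not
  -- needed here: the default sum `0` also commutes with `S`.
  have hR : Commute (R T m) S :=
    Commute.cfcₙ_nnreal (Commute.tsum_right S fun n => (h n).smul_right _).symm _
  simp only
  rw [hR.eq, mul_assoc]
  -- Invertibility of `R_m` need not be proved: otherwise `Ring.inverse` is `0` and the bound is
  -- trivial.
  by_cases hu : IsUnit (R T m)
  · rw [Ring.mul_inverse_cancel _ hu, mul_one]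
  · rw [Ring.inverse_non_unit _ hu]
    simp

end SpectralRadiusAlgebra

namespace WCE

/-! ### Multiplication and weighted conditional expectation operators on `L²` -/

section Operators

variable {X : Type*} {𝓐 𝓕 : MeasurableSpace X} {μ : @Measure X 𝓕}

/-- Multiplication by an essentially bounded function, as an operator on `L²`. -/
noncomputable def mulOp (φ : X → ℂ) (hφ : MemLp φ ∞ μ) : Lp ℂ 2 μ →L[ℂ] Lp ℂ 2 μ :=
  (ContinuousLinearMap.mul ℂ ℂ).holderL μ ∞ 2 2 (hφ.toLp φ)

theorem mulOp_apply_ae {φ : X → ℂ} (hφ : MemLp φ ∞ μ) (f : Lp ℂ 2 μ) :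
    mulOp φ hφ f =ᵐ[μ] fun x => φ x * f x := by
  filter_upwards [(ContinuousLinearMap.mul ℂ ℂ).coeFn_holder (r := 2) (hφ.toLp φ) f,
    hφ.coeFn_toLp] with x h1 h2
  rw [← h2]
  exact h1

theorem isSelfAdjoint_mulOp {φ : X → ℂ} (hφ : MemLp φ ∞ μ) (hr : ∀ x, conj (φ x) = φ x) :
    IsSelfAdjoint (mulOp φ hφ) := by
  rw [ContinuousLinearMap.isSelfAdjoint_iff_isSymmetric]
  intro f g
  rw [L2.inner_def, L2.inner_def]
  refine integral_congr_ae ?_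
  filter_upwards [mulOp_apply_ae hφ f, mulOp_apply_ae hφ g] with x h1 h2
  simp only [ContinuousLinearMap.coe_coe, RCLike.inner_apply, h1, h2, map_mul, hr]
  ring

theorem commute_mulOp (h𝓐 : 𝓐 ≤ 𝓕) [SigmaFinite (μ.trim h𝓐)] {φ w u : X → ℂ}
    {T : Lp ℂ 2 μ →L[ℂ] Lp ℂ 2 μ} (hT : IsWCE 𝓐 μ w u T) (hφ : MemLp φ ∞ μ)
    (hφm : Measurable[𝓐] φ) : Commute (mulOp φ hφ) T := by
  refine ContinuousLinearMap.ext fun f => Lp.ext ?_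
  have h0 : (fun y => u y * mulOp φ hφ f y) =ᵐ[μ] fun y => φ y * (u y * f y) := by
    filter_upwards [mulOp_apply_ae hφ f] with x h
    rw [h]
    ring
  change (mulOp φ hφ (T f) : X → ℂ) =ᵐ[μ] T (mulOp φ hφ f)
  filter_upwards [mulOp_apply_ae hφ (T f), (hT f).2, (hT (mulOp φ hφ f)).2, condE_congr h0,
    condE_mul h𝓐 hφm (hT f).1] with x h1 h2 h3 h4 h5
  rw [h1, h2, h3, h4, h5]
  ring

/-- `M_{a ū} E M_u` is self-adjoint when `a` is real and `𝓐`-measurable. -/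
theorem isSelfAdjoint_of_isWCE (h𝓐 : 𝓐 ≤ 𝓕) [SigmaFinite (μ.trim h𝓐)] {u : X → ℂ} {a : X → ℝ}
    (ha : Measurable[𝓐] a) {S : Lp ℂ 2 μ →L[ℂ] Lp ℂ 2 μ}
    (hS : IsWCE 𝓐 μ (fun x => (a x : ℂ) * conj (u x)) u S) : IsSelfAdjoint S := by
  rw [ContinuousLinearMap.isSelfAdjoint_iff_isSymmetric]
  intro f g
  have ha' : Measurable[𝓐] fun x => (a x : ℂ) := Complex.measurable_ofReal.comp ha
  have hE : ∀ f : Lp ℂ 2 μ, Measurable[𝓐] (condE 𝓐 μ fun y => u y * f y) := fun f =>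
    measurable_condE _
  change inner ℂ (S f) g = inner ℂ f (S g)
  -- `E` preserves integrals, so it suffices to compare the conditional expectations of the
  -- integrands; pull-out turns both into `a · conj E(uf) · E(ug)`.
  rw [L2.inner_def, L2.inner_def, ← integral_condE h𝓐 (L2.integrable_inner (𝕜 := ℂ) (S f) g),
    ← integral_condE h𝓐 (L2.integrable_inner (𝕜 := ℂ) f (S g))]
  refine integral_congr_ae ?_
  have h1 : (fun x => inner ℂ (S f x) (g x)) =ᵐ[μ] fun x =>
      ((a x : ℂ) * conj (condE 𝓐 μ (fun y => u y * f y) x)) * (u x * g x) := by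
    filter_upwards [(hS f).2] with x h
    simp only [RCLike.inner_apply, h, map_mul, Complex.conj_ofReal, Complex.conj_conj]
    ring
  have h2 : (fun x => inner ℂ (f x) (S g x)) =ᵐ[μ] fun x =>
      ((a x : ℂ) * condE 𝓐 μ (fun y => u y * g y) x) * conj (u x * f x) := by
    filter_upwards [(hS g).2] with x h
    simp only [RCLike.inner_apply, h, map_mul]
    ring
  filter_upwards [condE_congr (𝓐 := 𝓐) h1, condE_congr (𝓐 := 𝓐) h2,
    condE_mul h𝓐 (ha'.mul (Complex.continuous_conj.measurable.comp (hE f))) (hS g).1,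
    condE_mul h𝓐 (ha'.mul (hE g)) (hS f).1.conj] with x e1 e2 e3 e4
  rw [e1, e2]
  refine e3.trans (Eq.trans ?_ e4.symm)
  simp only [condE_conj, Pi.mul_apply, Function.comp]
  ring

theorem Conditionable.mul_conj_self {u : X → ℂ} (hu : AEStronglyMeasurable u μ)
    (hu2 : ∀ᵐ x ∂μ, condSq 𝓐 μ u x < ∞) : Conditionable 𝓐 μ fun x => u x * conj (u x) := by
  refine ⟨hu.mul (Complex.continuous_conj.comp_aestronglyMeasurable hu), ?_⟩
  have : (fun x => ‖u x * conj (u x)‖ₑ) = fun x => ‖u x‖ₑ ^ 2 := by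
    ext x
    rw [enorm_mul, RCLike.enorm_conj, sq]
  rw [this]
  exact hu2

theorem condE_mul_conj_self (u : X → ℂ) (x : X) :
    condE 𝓐 μ (fun x => u x * conj (u x)) x = ((condSq 𝓐 μ u x).toReal : ℂ) := by
  have h1 : (fun y => ENNReal.ofReal (‖u y‖ ^ 2)) = fun y => ‖u y‖ₑ ^ 2 := by
    ext y
    rw [ENNReal.ofReal_pow (norm_nonneg _), ofReal_norm]
  have h2 : (fun y => ENNReal.ofReal (-‖u y‖ ^ 2)) = (0 : X → ℝ≥0∞) := by
    ext y
    simp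
  have h3 : ∀ y, u y * conj (u y) = ((‖u y‖ ^ 2 : ℝ) : ℂ) := fun y => by
    rw [Complex.mul_conj, Complex.normSq_eq_norm_sq]
  have h4 : (fun _ => 0 : X → ℝ≥0∞) = 0 := rfl
  simp only [condE, condReal, h3, Complex.ofReal_re, Complex.ofReal_im, h1, h2, condSq,
    neg_zero, ENNReal.ofReal_zero, h4, condLExp_zero]
  simp

/-- `M_w E M_u M_{a ū} E M_u = M_{a E(|u|²)} M_w E M_u`. -/
theorem comp_apply_ae (h𝓐 : 𝓐 ≤ 𝓕) [SigmaFinite (μ.trim h𝓐)] {w u : X → ℂ} {a : X → ℝ}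
    (ha : Measurable[𝓐] a) (hu : AEStronglyMeasurable u μ)
    (hu2 : ∀ᵐ x ∂μ, condSq 𝓐 μ u x < ∞) {T S : Lp ℂ 2 μ →L[ℂ] Lp ℂ 2 μ}
    (hT : IsWCE 𝓐 μ w u T) (hS : IsWCE 𝓐 μ (fun x => (a x : ℂ) * conj (u x)) u S)
    (f : Lp ℂ 2 μ) :
    T (S f) =ᵐ[μ] fun x => ((a x * (condSq 𝓐 μ u x).toReal : ℝ) : ℂ) * T f x := by
  have ha' : Measurable[𝓐] fun x => (a x : ℂ) := Complex.measurable_ofReal.comp ha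
  -- The factor `a E(uf)` is `𝓐`-measurable and leaves `E`; what stays inside is `|u|²`.
  have h0 : (fun y => u y * S f y) =ᵐ[μ] fun y =>
      ((a y : ℂ) * condE 𝓐 μ (fun y => u y * f y) y) * (u y * conj (u y)) := by
    filter_upwards [(hS f).2] with x h
    rw [h]
    ring
  filter_upwards [(hT (S f)).2, (hT f).2, condE_congr (𝓐 := 𝓐) h0,
    condE_mul h𝓐 (ha'.mul (measurable_condE fun y => u y * f y))
      (Conditionable.mul_conj_self hu hu2)] with x h1 h2 h3 h4
  rw [h1, h2, h3]
  refine (congrArg (w x * ·) h4).trans ?_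
  simp only [condE_mul_conj_self, Pi.mul_apply]
  push_cast
  ring

/-- `M_{a ū} E M_u` commutes with `T*^n T^n` for `T = M_w E M_u`. The possibly unbounded multiplier
`a E(|u|²)` is handled by cutting to the sets `{|a E(|u|²)| ≤ k}`. -/
theorem commute_adjoint_pow_mul_pow (h𝓐 : 𝓐 ≤ 𝓕) [SigmaFinite (μ.trim h𝓐)] {w u : X → ℂ}
    {a : X → ℝ} (ha : Measurable[𝓐] a) (hu : AEStronglyMeasurable u μ)
    (hu2 : ∀ᵐ x ∂μ, condSq 𝓐 μ u x < ∞) {T S : Lp ℂ 2 μ →L[ℂ] Lp ℂ 2 μ}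
    (hT : IsWCE 𝓐 μ w u T) (hS : IsWCE 𝓐 μ (fun x => (a x : ℂ) * conj (u x)) u S) (n : ℕ) :
    Commute S (ContinuousLinearMap.adjoint T ^ n * T ^ n) := by
  let m : X → ℝ := fun x => a x * (condSq 𝓐 μ u x).toReal
  have hm : Measurable[𝓐] m := ha.mul (measurable_condLExp 𝓐 μ _).ennreal_toReal
  let B : ℕ → Set X := fun k => {x | |m x| ≤ k}
  have hB : ∀ k, MeasurableSet[𝓐] (B k) := fun k =>
    (measurable_norm.comp hm) measurableSet_Iic
  let φ : ℕ → X → ℂ := fun k => (B k).indicator 1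
  let ψ : ℕ → X → ℂ := fun k => (B k).indicator fun x => (m x : ℂ)
  have hφm : ∀ k, Measurable[𝓐] (φ k) := fun k =>
    (@measurable_one ℂ X _ 𝓐 _).indicator (hB k)
  have hψm : ∀ k, Measurable[𝓐] (ψ k) := fun k =>
    (Complex.measurable_ofReal.comp hm).indicator (hB k)
  have hφ : ∀ k, MemLp (φ k) ∞ μ := fun k =>
    memLp_top_of_bound ((hφm k).mono h𝓐 le_rfl).aestronglyMeasurable 1 <| .of_forall fun x => by
      by_cases hx : x ∈ B k <;> simp [φ, hx]
  have hψ : ∀ k, MemLp (ψ k) ∞ μ := fun k =>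
    memLp_top_of_bound ((hψm k).mono h𝓐 le_rfl).aestronglyMeasurable k <| .of_forall fun x => by
      by_cases hx : x ∈ B k
      · have hx' : |m x| ≤ k := hx
        simpa only [ψ, Set.indicator_of_mem hx, Complex.norm_real, Real.norm_eq_abs] using hx'
      · simp [ψ, hx]
  set Q := ContinuousLinearMap.adjoint T ^ n * T ^ n with hQ
  -- The algebraic lemma is applied to the self-adjoint `M_φ S`, with the bounded multiplier `ψ = φ
  -- m` in the role of `N`.
  have key : ∀ k, mulOp (φ k) (hφ k) * (S * Q) = mulOp (φ k) (hφ k) * (Q * S) := by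
    intro k
    have hMT := commute_mulOp h𝓐 hT (hφ k) (hφm k)
    have hMS := commute_mulOp h𝓐 hS (hφ k) (hφm k)
    have hMsa : IsSelfAdjoint (mulOp (φ k) (hφ k)) := isSelfAdjoint_mulOp _ fun x => by
      by_cases hx : x ∈ B k <;> simp [φ, hx]
    have hNsa : IsSelfAdjoint (mulOp (ψ k) (hψ k)) := isSelfAdjoint_mulOp _ fun x => by
      by_cases hx : x ∈ B k <;> simp [ψ, hx]
    have hMSsa : IsSelfAdjoint (mulOp (φ k) (hφ k) * S) :=
      (hMsa.commute_iff (isSelfAdjoint_of_isWCE h𝓐 ha hS)).1 hMS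
    have hTMS : T * (mulOp (φ k) (hφ k) * S) = mulOp (ψ k) (hψ k) * T := by
      rw [← mul_assoc, ← hMT.eq, mul_assoc]
      refine ContinuousLinearMap.ext fun f => Lp.ext ?_
      change (mulOp (φ k) (hφ k) (T (S f)) : X → ℂ) =ᵐ[μ] mulOp (ψ k) (hψ k) (T f)
      filter_upwards [mulOp_apply_ae (hφ k) (T (S f)), mulOp_apply_ae (hψ k) (T f),
        comp_apply_ae h𝓐 ha hu hu2 hT hS f] with x h1 h2 h3
      rw [h1, h2, h3]
      by_cases hx : x ∈ B k <;> simp [φ, ψ, hx, m]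
    have hMSQ : Commute (mulOp (φ k) (hφ k) * S) Q :=
      SpectralRadiusAlgebra.commute_star_pow_mul_pow hMSsa hNsa hTMS
        (commute_mulOp h𝓐 hT (hψ k) (hψm k)) n
    have hMT' : Commute (mulOp (φ k) (hφ k)) (ContinuousLinearMap.adjoint T) := by
      have := hMT.star_star
      rwa [hMsa.star_eq] at this
    have hMQ : Commute (mulOp (φ k) (hφ k)) Q := (hMT'.pow_right n).mul_right (hMT.pow_right n)
    rw [← mul_assoc, hMSQ.eq, ← mul_assoc, ← hMQ.eq, mul_assoc]
  refine ContinuousLinearMap.ext fun f => Lp.ext ?_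
  -- A single null set serves all `k`; off it, choosing `k ≥ |m x|` makes `φ k x = 1`.
  have hall : ∀ᵐ x ∂μ, ∀ k, φ k x * (S * Q) f x = φ k x * (Q * S) f x := by
    refine ae_all_iff.2 fun k => ?_
    have h := congrArg (fun L : Lp ℂ 2 μ →L[ℂ] Lp ℂ 2 μ => (L f : X → ℂ)) (key k)
    filter_upwards [mulOp_apply_ae (hφ k) ((S * Q) f), mulOp_apply_ae (hφ k) ((Q * S) f)]
      with x h1 h2
    rw [← h1, ← h2]
    exact congrFun h x
  filter_upwards [hall] with x hx
  obtain ⟨k, hk⟩ := exists_nat_ge |m x|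
  have hxk : x ∈ B k := hk
  simpa [φ, hxk] using hx k

end Operators

end WCE

theorem proposition2p4 {X : Type*} {𝓐 𝓕 : MeasurableSpace X} (h𝓐 : 𝓐 ≤ 𝓕)
    (μ : @MeasureTheory.Measure X 𝓕) [MeasureTheory.SigmaFinite μ]
    [MeasureTheory.SigmaFinite (μ.trim h𝓐)]
    (w u : X → ℂ) (hw : WCE.Conditionable 𝓐 μ w) (hu : WCE.Conditionable 𝓐 μ u)
    (hu2 : ∃ C : ℝ≥0, ∀ᵐ x ∂μ, WCE.condSq 𝓐 μ u x ≤ C)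
    (T : Lp ℂ 2 μ →L[ℂ] Lp ℂ 2 μ) (hT : WCE.IsWCE 𝓐 μ w u T)
    (a : X → ℝ) (ha : AEStronglyMeasurable[𝓐] a μ) (ha0 : ∀ᵐ x ∂μ, 0 ≤ a x)
    (S : Lp ℂ 2 μ →L[ℂ] Lp ℂ 2 μ)
    (hS : WCE.IsWCE 𝓐 μ (fun x => (a x : ℂ) * conj (u x)) u S) :
    S ∈ SpectralRadiusAlgebra.spectralRadiusAlgebra T := by
  -- Pull-out is stated for genuinely `𝓐`-measurable factors, so `a` is replaced by such a version
  -- `b`.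
  obtain ⟨b, hb, hab⟩ := ha
  obtain ⟨C, hC⟩ := hu2
  have hSb : WCE.IsWCE 𝓐 μ (fun x => (b x : ℂ) * conj (u x)) u S := fun f => by
    refine ⟨(hS f).1, ?_⟩
    filter_upwards [(hS f).2, hab] with x h1 h2
    rw [h1, h2]
  exact SpectralRadiusAlgebra.mem_spectralRadiusAlgebra_of_commute fun n =>
    WCE.commute_adjoint_pow_mul_pow h𝓐 hb.measurable hu.1
      (hC.mono fun _ hx => hx.trans_lt ENNReal.coe_lt_top) hT hSb n
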